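/- Let $E$ be a complex Banach space with dual $E^*$, and for $x\in E$ put $$J(x)=\{x^*\in E^* : \langle x,x^*\rangle=\|x\|^2=\|x^*\|^2\}.$$ A linear operator $A:D(A)\subset E\to E$ is called dissipative if for every $x\in D(A)$ there is $x^*\in J(x)$ with $\operatorname{Re}\langle Ax,x^*\rangle\le 0$. It is called $m$-dissipative if it is dissipative and there is $\alpha_0>0$ with $\operatorname{Im}(\alpha_0 I-A)=\{\alpha_0x-Ax : x\in D(A)\}=E$. A $C_0$-semigroup of contractions on $E$ is a family $\{T(t)\}_{t\ge 0}$ of bounded linear operators on $E$ such that $T(0)=I$, $T(t+s)=T(t)T(s)$ for all $t,s\ge 0$, $\lim_{t\searrow 0}T(t)x=x$ for all $x\in E$, and $\|T(t)\|\le 1$ for all $t\ge 0$. Its infinitesimal generator is the operator whose domain is the set of all $x\in E$ for which $\lim_{t\searrow 0}\frac{T(t)x-x}{t}$ exists in $E$, and whose value at such an $x$ is this limit. **Theorem (Lumer–Phillips).** Let $A:D(A)\subset E\to E$ be a linear operator with $\overline{D(A)}=E$. Then $A$ is the infinitesimal generator of a $C_0$-semigroup of contractions on $E$ if and only if $A$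 is $m$-dissipative. -/

import Mathlib

open Filter Topology

/-- A family `T(t)`, `t ≥ 0`, of bounded linear operators on `E` (only the values of `T` on
`[0, ∞)` matter) is a `C₀`-semigroup. -/
structure IsC0Semigroup {E : Type*} [NormedAddCommGroup E] [NormedSpace ℂ E]
    (T : ℝ → E →L[ℂ] E) : Prop where
  map_zero : T 0 = ContinuousLinearMap.id ℂ E
  map_add : ∀ t s : ℝ, 0 ≤ t → 0 ≤ s → T (t + s) = (T t).comp (T s)
  tendsto_zero : ∀ x : E, Tendsto (fun t : ℝ => T t x) (𝓝[>] 0) (𝓝 x)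

/-- The class `SG(M, ω)`: the `C₀`-semigroups with `‖T(t)‖ ≤ M e^{ω t}` for all `t ≥ 0`. -/
structure IsC0SemigroupOfType {E : Type*} [NormedAddCommGroup E] [NormedSpace ℂ E]
    (M ω : ℝ) (T : ℝ → E →L[ℂ] E) : Prop extends IsC0Semigroup T where
  norm_le : ∀ t : ℝ, 0 ≤ t → ‖T t‖ ≤ M * Real.exp (ω * t)

/-- A `C₀`-semigroup of contractions: a member of `SG(1, 0)`. -/
def IsContractionC0Semigroup {E : Type*} [NormedAddCommGroup E] [NormedSpace ℂ E]
    (T : ℝ → E →L[ℂ] E) : Prop :=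
  IsC0SemigroupOfType 1 0 T

/-- `A` is the infinitesimal generator of `T`: the domain of `A` is exactly the set of `x` for
which `lim_{t ↘ 0} (T(t)x - x)/t` exists, and `A x` is that limit. -/
structure IsInfinitesimalGenerator {E : Type*} [NormedAddCommGroup E] [NormedSpace ℂ E]
    (A : E →ₗ.[ℂ] E) (T : ℝ → E →L[ℂ] E) : Prop where
  mem_domain_iff : ∀ x : E, x ∈ A.domain ↔
    ∃ y : E, Tendsto (fun t : ℝ => t⁻¹ • (T t x - x)) (𝓝[>] 0) (𝓝 y)
  tendsto_apply : ∀ x : A.domain,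
    Tendsto (fun t : ℝ => t⁻¹ • (T t (x : E) - (x : E))) (𝓝[>] 0) (𝓝 (A x))

/-- The duality map `J(x) = {x* ∈ E* | ⟨x, x*⟩ = ‖x‖² = ‖x*‖²}`. -/
def dualityMap {E : Type*} [NormedAddCommGroup E] [NormedSpace ℂ E] (x : E) :
    Set (StrongDual ℂ E) :=
  {f | f x = ((‖x‖ ^ 2 : ℝ) : ℂ) ∧ ‖x‖ ^ 2 = ‖f‖ ^ 2}

/-- `A` is dissipative: for every `x ∈ D(A)` there is `x* ∈ J(x)` with `Re ⟨A x, x*⟩ ≤ 0`. -/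
def IsDissipative {E : Type*} [NormedAddCommGroup E] [NormedSpace ℂ E]
    (A : E →ₗ.[ℂ] E) : Prop :=
  ∀ x : A.domain, ∃ f ∈ dualityMap (x : E), (f (A x)).re ≤ 0

/-- `A` is m-dissipative: `A` is dissipative and `α₀ I - A : D(A) → E` is onto for some
`α₀ > 0`. -/
structure IsMDissipative {E : Type*} [NormedAddCommGroup E] [NormedSpace ℂ E]
    (A : E →ₗ.[ℂ] E) : Prop where
  isDissipative : IsDissipative A
  exists_range_eq_univ : ∃ α₀ : ℝ, 0 < α₀ ∧
    Set.range (fun x : A.domain => (α₀ : ℂ) • (x : E) - A x) = Set.univ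

/-! ### Necessity: generators of contraction semigroups are m-dissipative. -/

section Semigroup

variable {E : Type*} [NormedAddCommGroup E] [NormedSpace ℂ E]

/-! Necessity. For `f ∈ J(x)` a contraction semigroup has `Re f(T(t)x - x) ≤ 0`; dividing by `t` and
letting `t ↘ 0` gives dissipativity. The Laplace transform `x = ∫₀^∞ e^{-t} T(t)y dt` solves `x - Ax
= y`, so `α₀ = 1` works.

Sufficiency (Yosida). Dissipativity gives `l‖x‖ ≤ ‖lx - Ax‖` (`IsDissipative.mul_norm_le`), so
surjectivity at one `l > 0` yields a resolvent of norm at most `1/l`. A Neumann series carries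
surjectivity from `l` to `(0, 2l)`, hence to some `lₙ → ∞` with resolvents `Rₙ`. The bounded
operators `Bₙ = lₙ(lₙRₙ - 1)` commute, generate contractions, and converge to `A` on `D(A)`.
Commutation gives `‖e^{tBₘ}x - e^{tBₙ}x‖ ≤ t‖Bₘx - Bₙx‖`, so the exponentials converge strongly to a
contraction semigroup whose generator extends `A`. The extension is not proper: that generator is
dissipative, so it has no positive eigenvalue, while `l - A` is already onto. -/

lemma dualityMap_nonempty (x : E) : (dualityMap x).Nonempty := by
  rcases eq_or_ne x 0 with rfl | hx
  · exact ⟨0, by simp [dualityMap]⟩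
  · obtain ⟨g, hg, hgx⟩ := exists_dual_vector ℂ x (norm_ne_zero_iff.2 hx)
    refine ⟨(‖x‖ : ℂ) • g, ?_, ?_⟩
    · simp [hgx, sq]
    · simp [norm_smul, hg]

lemma re_apply_le_of_mem_dualityMap {x : E} {f : StrongDual ℂ E} (hf : f ∈ dualityMap x) (y : E) :
    (f y).re ≤ ‖x‖ * ‖y‖ := by
  have h : ‖f‖ = ‖x‖ := ((sq_eq_sq₀ (norm_nonneg _) (norm_nonneg _)).1 hf.2).symm
  exact (Complex.re_le_norm _).trans ((f.le_opNorm y).trans_eq (by rw [h]))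

namespace IsContractionC0Semigroup

variable {T : ℝ → E →L[ℂ] E} (hT : IsContractionC0Semigroup T)
include hT

lemma norm_le_one {t : ℝ} (ht : 0 ≤ t) : ‖T t‖ ≤ 1 := by
  simpa using hT.norm_le t ht

lemma norm_apply_le {t : ℝ} (ht : 0 ≤ t) (x : E) : ‖T t x‖ ≤ ‖x‖ :=
  (T t).le_of_opNorm_le_of_le (hT.norm_le_one ht) le_rfl |>.trans_eq (one_mul _)

lemma norm_sub_le {s t : ℝ} (hs : 0 ≤ s) (hst : s ≤ t) (x : E) :
    ‖T t x - T s x‖ ≤ ‖T (t - s) x - x‖ := by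
  have h := hT.map_add s (t - s) hs (sub_nonneg.2 hst)
  rw [add_sub_cancel] at h
  rw [h, ContinuousLinearMap.comp_apply, ← map_sub]
  exact hT.norm_apply_le hs _

/-- An increment of an orbit is bounded by `‖T(|s - t|)x - x‖`, so right continuity at `0` suffices.
The `max` extends the orbit to the whole line, since `T` is arbitrary at negative times. -/
lemma continuous_max_zero (x : E) : Continuous fun t : ℝ => T (max t 0) x := by
  have h0 : Tendsto (fun t : ℝ => ‖T t x - x‖) (𝓝[≥] 0) (𝓝 0) := by
    rw [← Set.Ioi_insert, nhdsWithin_insert, tendsto_sup]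
    constructor
    · rw [tendsto_pure_left]
      intro s hs
      simpa [hT.map_zero] using mem_of_mem_nhds hs
    · simpa using ((hT.tendsto_zero x).sub_const x).norm
  rw [continuous_iff_continuousAt]
  intro t
  rw [ContinuousAt, tendsto_iff_norm_sub_tendsto_zero]
  have habs : Tendsto (fun s : ℝ => |max s 0 - max t 0|) (𝓝 t) (𝓝[≥] 0) := by
    refine tendsto_nhdsWithin_iff.2 ⟨?_, Eventually.of_forall fun s => Set.mem_Ici.2 (abs_nonneg _)⟩
    have : Continuous fun s : ℝ => |max s 0 - max t 0| := by fun_prop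
    simpa using this.tendsto t
  refine squeeze_zero (fun _ => norm_nonneg _) (fun s => ?_) (h0.comp habs)
  rcases le_total (max t 0) (max s 0) with h | h
  · simpa [abs_of_nonneg (sub_nonneg.2 h)] using hT.norm_sub_le (le_max_right t 0) h x
  · rw [norm_sub_rev, Function.comp_apply, abs_sub_comm, abs_of_nonneg (sub_nonneg.2 h)]
    exact hT.norm_sub_le (le_max_right s 0) h x

end IsContractionC0Semigroup

/-- Valid for every `f ∈ J(x)` and any one-sided derivative `y`, without reference to `A`; this is
what allows its reuse for the maximality of `A`. -/
lemma IsContractionC0Semigroup.re_apply_nonpos {T : ℝ → E →L[ℂ] E}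
    (hT : IsContractionC0Semigroup T) {x y : E}
    (hy : Tendsto (fun t : ℝ => t⁻¹ • (T t x - x)) (𝓝[>] 0) (𝓝 y))
    {f : StrongDual ℂ E} (hf : f ∈ dualityMap x) : (f y).re ≤ 0 := by
  have hlim := (Complex.continuous_re.tendsto _).comp ((f.continuous.tendsto _).comp hy)
  refine le_of_tendsto hlim ?_
  filter_upwards [self_mem_nhdsWithin] with t ht
  have ht : (0 : ℝ) < t := ht
  have h1 := re_apply_le_of_mem_dualityMap hf (T t x)
  have h2 := mul_le_mul_of_nonneg_left (hT.norm_apply_le ht.le x) (norm_nonneg x)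
  have h3 : (f x).re = ‖x‖ ^ 2 := by rw [hf.1, Complex.ofReal_re]
  have h4 : (f (t⁻¹ • (T t x - x))).re = t⁻¹ * ((f (T t x)).re - ‖x‖ ^ 2) := by
    rw [← h3, ← Complex.coe_smul, map_smul, map_sub, smul_eq_mul, Complex.re_ofReal_mul,
      Complex.sub_re]
  simp only [Function.comp_apply, h4]
  exact mul_nonpos_of_nonneg_of_nonpos (inv_nonneg.2 ht.le) (by nlinarith)

lemma IsInfinitesimalGenerator.isDissipative {A : E →ₗ.[ℂ] E} {T : ℝ → E →L[ℂ] E}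
    (hA : IsInfinitesimalGenerator A T) (hT : IsContractionC0Semigroup T) : IsDissipative A :=
  fun x => (dualityMap_nonempty (x : E)).imp fun _ hf =>
    ⟨hf, hT.re_apply_nonpos (hA.tendsto_apply x) hf⟩

-- The witness is the resolvent at `1`, written as the Laplace transform of the orbit of `y`.
open MeasureTheory Set in
lemma IsContractionC0Semigroup.exists_tendsto_sub [CompleteSpace E] {T : ℝ → E →L[ℂ] E}
    (hT : IsContractionC0Semigroup T) (y : E) :
    ∃ x : E, Tendsto (fun t : ℝ => t⁻¹ • (T t x - x)) (𝓝[>] 0) (𝓝 (x - y)) := by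
  set u : ℝ → E := fun t => Real.exp (-t) • T (max t 0) y with hu
  have hucont : Continuous u :=
    (Real.continuous_exp.comp continuous_neg).smul (hT.continuous_max_zero y)
  have hint : IntegrableOn u (Ioi 0) := by
    refine ((integrableOn_exp_neg_Ioi 0).mul_const ‖y‖).mono'
      hucont.aestronglyMeasurable.restrict (Eventually.of_forall fun t => ?_)
    rw [hu, norm_smul, Real.norm_of_nonneg (Real.exp_nonneg _)]
    exact mul_le_mul_of_nonneg_left (hT.norm_apply_le (le_max_right _ _) y) (Real.exp_nonneg _)
  refine ⟨∫ t in Ioi 0, u t, ?_⟩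
  set x := ∫ t in Ioi 0, u t with hx
  -- Substituting `t ↦ t + h` gives `T(h)x = e^h ∫_h^∞ u`, whose right derivative at `h = 0` is `x -
  -- u(0) = x - y`.
  have key : ∀ h : ℝ, 0 < h → T h x = Real.exp h • (x - ∫ t in (0 : ℝ)..h, u t) := by
    intro h hh
    have h1 : (x - ∫ t in (0 : ℝ)..h, u t) = ∫ t in Ioi h, u t := by
      rw [hx, ← intervalIntegral.integral_interval_add_Ioi hint
        (hint.mono_set (Ioi_subset_Ioi hh.le)), add_sub_cancel_left]
    have h2 : ∫ t in Ioi h, u t = ∫ t in Ioi 0, u (t + h) := by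
      rw [← (measurePreserving_add_right volume h).setIntegral_preimage_emb
        (measurableEmbedding_addRight h)]
      simp
    rw [h1, h2, hx, ← ContinuousLinearMap.integral_comp_comm _ hint, ← integral_smul]
    refine setIntegral_congr_fun measurableSet_Ioi fun t ht => ?_
    have ht : (0 : ℝ) < t := ht
    have hTadd := congrArg (fun S => S y) (hT.map_add h t hh.le ht.le)
    simp only [ContinuousLinearMap.comp_apply] at hTadd
    simp only [hu]
    rw [max_eq_left ht.le, max_eq_left (by positivity), add_comm t h, hTadd, smul_smul,
      ← Real.exp_add, ← Complex.coe_smul, map_smul, Complex.coe_smul]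
    congr 2
    ring
  have hexp : Tendsto (fun h : ℝ => h⁻¹ • (Real.exp h - 1)) (𝓝[>] 0) (𝓝 1) := by
    have := (Real.hasDerivAt_exp 0).hasDerivWithinAt (s := Ioi 0)
    rw [hasDerivWithinAt_iff_tendsto_slope' (by simp)] at this
    simpa [slope_fun_def] using this
  have hI : Tendsto (fun h : ℝ => h⁻¹ • ∫ t in (0 : ℝ)..h, u t) (𝓝[>] 0) (𝓝 y) := by
    have := (hucont.integral_hasStrictDerivAt 0 0).hasDerivAt.hasDerivWithinAt (s := Ioi 0)
    rw [hasDerivWithinAt_iff_tendsto_slope' (by simp)] at this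
    simpa [slope_fun_def, hu, hT.map_zero] using this
  have hexp' : Tendsto Real.exp (𝓝[>] 0) (𝓝 1) := by
    simpa using (Real.continuous_exp.tendsto 0).mono_left nhdsWithin_le_nhds
  have hlim := (hexp.smul_const x).sub (hexp'.smul hI)
  rw [one_smul, one_smul] at hlim
  refine hlim.congr' ?_
  filter_upwards [self_mem_nhdsWithin] with h hh
  rw [key h hh]
  module

lemma IsInfinitesimalGenerator.isMDissipative [CompleteSpace E] {A : E →ₗ.[ℂ] E}
    {T : ℝ → E →L[ℂ] E} (hA : IsInfinitesimalGenerator A T) (hT : IsContractionC0Semigroup T) :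
    IsMDissipative A := by
  refine ⟨hA.isDissipative hT, 1, one_pos, Set.eq_univ_of_forall fun y => ?_⟩
  obtain ⟨x, hx⟩ := hT.exists_tendsto_sub y
  have hmem : x ∈ A.domain := (hA.mem_domain_iff x).2 ⟨_, hx⟩
  refine ⟨⟨x, hmem⟩, ?_⟩
  simp [tendsto_nhds_unique (hA.tendsto_apply ⟨x, hmem⟩) hx]

end Semigroup

/-! ### Exponentials of bounded operators and contraction estimates. -/

section Exponential

open NormedSpace

section Algebra

variable {𝔸 : Type*} [NormedRing 𝔸] [NormedAlgebra ℂ 𝔸]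

/-- Assuming `‖1‖ ≤ 1` rather than `‖1‖ = 1` keeps the zero space `E` included. -/
lemma norm_exp_le_exp_norm_of_norm_one_le (h1 : ‖(1 : 𝔸)‖ ≤ 1) (x : 𝔸) :
    ‖exp x‖ ≤ Real.exp ‖x‖ := by
  have hr : HasSum (fun n : ℕ => ‖x‖ ^ n / n.factorial) (Real.exp ‖x‖) := by
    rw [Real.exp_eq_exp_ℝ]
    exact expSeries_div_hasSum_exp ‖x‖
  rw [exp_eq_tsum ℂ]
  refine tsum_of_norm_bounded hr fun n => ?_
  rw [norm_smul, norm_inv, Complex.norm_natCast, div_eq_inv_mul]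
  gcongr
  cases n with
  | zero => simpa using h1
  | succ n => exact norm_pow_le' x n.succ_pos

lemma commute_exp_real_smul {B C : 𝔸} (h : Commute B C) (t : ℝ) : Commute (exp (t • B)) C := by
  let _ : NormedAlgebra ℚ 𝔸 := .restrictScalars ℚ ℂ 𝔸
  exact (h.smul_left t).exp_left

variable [CompleteSpace 𝔸]

lemma exp_add_smul_real (s t : ℝ) (B : 𝔸) : exp ((s + t) • B) = exp (s • B) * exp (t • B) := by
  let _ : NormedAlgebra ℚ 𝔸 := .restrictScalars ℚ ℂ 𝔸
  rw [add_smul]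
  exact exp_add_of_commute (((Commute.refl B).smul_left s).smul_right t)

/-- Because `e^{c(S-1)} = e^{-c} e^{cS}` and `‖e^{cS}‖ ≤ e^c`. -/
lemma norm_exp_smul_sub_one_le (h1 : ‖(1 : 𝔸)‖ ≤ 1) {S : 𝔸} (hS : ‖S‖ ≤ 1) {c : ℝ} (hc : 0 ≤ c) :
    ‖exp (c • (S - 1))‖ ≤ 1 := by
  let _ : NormedAlgebra ℚ 𝔸 := .restrictScalars ℚ ℂ 𝔸
  have h : c • (S - 1) = c • S + algebraMap ℝ 𝔸 (-c) := by
    rw [Algebra.algebraMap_eq_smul_one]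
    module
  have h2 : ‖exp (algebraMap ℝ 𝔸 (-c))‖ ≤ Real.exp (-c) := by
    rw [← algebraMap_exp_comm, ← Real.exp_eq_exp_ℝ, norm_algebraMap,
      Real.norm_of_nonneg (Real.exp_nonneg _)]
    exact mul_le_of_le_one_right (Real.exp_nonneg _) h1
  have h3 : ‖exp (c • S)‖ ≤ Real.exp c := by
    refine (norm_exp_le_exp_norm_of_norm_one_le h1 _).trans (Real.exp_le_exp.2 ?_)
    rw [norm_smul, Real.norm_of_nonneg hc]
    exact mul_le_of_le_one_right hc hS
  rw [h, exp_add_of_commute (Algebra.commutes _ _).symm]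
  calc _ ≤ ‖exp (c • S)‖ * ‖exp (algebraMap ℝ 𝔸 (-c))‖ := norm_mul_le _ _
    _ ≤ Real.exp c * Real.exp (-c) := by gcongr
    _ = 1 := by rw [← Real.exp_add]; simp

end Algebra

variable {E : Type*} [NormedAddCommGroup E] [NormedSpace ℂ E]

/-- The operator `B` generates a norm-continuous semigroup of contractions. -/
def HasContractiveExp (B : E →L[ℂ] E) : Prop :=
  ∀ t : ℝ, 0 ≤ t → ‖exp (t • B)‖ ≤ 1

lemma HasContractiveExp.norm_apply_le {B : E →L[ℂ] E} (hB : HasContractiveExp B) {t : ℝ} (ht : 0 ≤ t) (x : E) :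
    ‖exp (t • B) x‖ ≤ ‖x‖ :=
  ((exp (t • B)).le_of_opNorm_le_of_le (hB t ht) le_rfl).trans_eq (one_mul _)

variable [CompleteSpace E]

lemma hasDerivAt_exp_smul_apply (B : E →L[ℂ] E) (x : E) (t : ℝ) :
    HasDerivAt (fun s : ℝ => exp (s • B) x) (exp (t • B) (B x)) t :=
  ((ContinuousLinearMap.apply ℂ E x).restrictScalars ℝ).hasFDerivAt.comp_hasDerivAt t
    (hasDerivAt_exp_smul_const B t)

namespace HasContractiveExp

variable {B C : E →L[ℂ] E}

/-- The path `s ↦ e^{sB}e^{(t-s)C}x` joins `e^{tC}x` to `e^{tB}x`; by commutation its derivative is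
a contraction applied to `Bx - Cx`. -/
lemma norm_apply_sub_apply_le (hB : HasContractiveExp B) (hC : HasContractiveExp C)
    (hBC : Commute B C) {t : ℝ} (ht : 0 ≤ t) (x : E) :
    ‖exp (t • B) x - exp (t • C) x‖ ≤ t * ‖B x - C x‖ := by
  have hd : ∀ s : ℝ, HasDerivAt (fun s : ℝ => (exp (s • B) * exp ((t - s) • C)) x)
      ((exp (s • B) * exp ((t - s) • C)) (B x - C x)) s := by
    intro s
    have h1 := hasDerivAt_exp_smul_const (𝕂 := ℝ) B s
    have h2 := (hasDerivAt_exp_smul_const (𝕂 := ℝ) C (t - s)).scomp s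
      ((hasDerivAt_id s).const_sub t)
    have h3 := ((ContinuousLinearMap.apply ℂ E x).restrictScalars ℝ).hasFDerivAt.comp_hasDerivAt s (h1.mul h2)
    refine h3.congr_deriv ?_
    have hc := commute_exp_real_smul hBC.symm (t - s)
    have : exp (s • B) * B * exp ((t - s) • C) = exp (s • B) * exp ((t - s) • C) * B := by
      rw [mul_assoc, mul_assoc, hc.eq]
    simp only [Function.comp_apply, this]
    simp [sub_eq_add_neg]
  have := norm_image_sub_le_of_norm_deriv_le_segment' (a := 0) (b := t)
    (fun s _ => (hd s).hasDerivWithinAt) (C := ‖B x - C x‖)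
    (fun s hs => (hB.norm_apply_le hs.1 _).trans (hC.norm_apply_le (sub_nonneg.2 hs.2.le) _))
    t ⟨ht, le_rfl⟩
  simpa [mul_comm] using this

lemma norm_apply_sub_le (hB : HasContractiveExp B) {t : ℝ} (ht : 0 ≤ t) (x : E) :
    ‖exp (t • B) x - x‖ ≤ t * ‖B x‖ := by
  have h0 : HasContractiveExp (0 : E →L[ℂ] E) := fun t _ => by
    rw [smul_zero, exp_zero]
    exact ContinuousLinearMap.norm_id_le
  simpa using hB.norm_apply_sub_apply_le h0 (Commute.zero_right B) ht x

/-- A first-order expansion whose error survives the limit `Bₙ → A`. Since `Ax` need not lie in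
`D(A)`, `B(Bx)` cannot be controlled; `Bx` is therefore replaced by a nearby `z` for which `Bz`
stays bounded. -/
lemma norm_apply_sub_sub_le (hB : HasContractiveExp B) {t : ℝ} (ht : 0 ≤ t) (x z : E) :
    ‖exp (t • B) x - x - t • B x‖ ≤ t * (2 * ‖B x - z‖ + t * ‖B z‖) := by
  have hd : ∀ s : ℝ, HasDerivAt (fun s : ℝ => exp (s • B) x - s • B x)
      (exp (s • B) (B x) - B x) s := fun s =>
    ((hasDerivAt_exp_smul_apply B x s).sub
      ((hasDerivAt_id s).smul_const (B x))).congr_deriv (by simp)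
  have hb : ∀ s ∈ Set.Ico 0 t, ‖exp (s • B) (B x) - B x‖ ≤ 2 * ‖B x - z‖ + t * ‖B z‖ := by
    intro s hs
    have h1 := hB.norm_apply_le hs.1 (B x - z)
    have h2 := (hB.norm_apply_sub_le hs.1 z).trans
      (mul_le_mul_of_nonneg_right hs.2.le (norm_nonneg _))
    calc ‖exp (s • B) (B x) - B x‖
        = ‖exp (s • B) (B x - z) + (exp (s • B) z - z) - (B x - z)‖ := by
          rw [map_sub]; congr 1; abel
      _ ≤ ‖exp (s • B) (B x - z)‖ + ‖exp (s • B) z - z‖ + ‖B x - z‖ :=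
          (norm_sub_le _ _).trans (add_le_add_left (norm_add_le _ _) _)
      _ ≤ _ := by linarith
  have := norm_image_sub_le_of_norm_deriv_le_segment' (a := 0) (b := t)
    (fun s _ => (hd s).hasDerivWithinAt) hb t ⟨ht, le_rfl⟩
  simpa [mul_comm, sub_right_comm] using this

end HasContractiveExp

end Exponential

/-! ### Strong convergence of contractions from a dense set. -/

section DenseConvergence

variable {E : Type*} [NormedAddCommGroup E] [NormedSpace ℂ E]

lemma tendsto_apply_of_dense_of_norm_le_one {ι : Type*} {l : Filter ι} {L : ι → E →L[ℂ] E}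
    (hL : ∀ᶠ i in l, ‖L i‖ ≤ 1) {D : Set E} (hD : Dense D)
    (h : ∀ x ∈ D, Tendsto (fun i => L i x) l (𝓝 x)) (x : E) :
    Tendsto (fun i => L i x) l (𝓝 x) := by
  rw [Metric.tendsto_nhds]
  intro ε hε
  obtain ⟨z, hz, hxz⟩ := Metric.dense_iff.1 hD x (ε / 3) (by positivity)
  filter_upwards [hL, Metric.tendsto_nhds.1 (h z hxz) (ε / 3) (by positivity)] with i hi hiz
  have h1 : dist (L i x) (L i z) ≤ dist x z := by
    rw [dist_eq_norm, dist_eq_norm, ← map_sub]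
    exact ((L i).le_of_opNorm_le_of_le hi le_rfl).trans_eq (one_mul _)
  have h2 : dist z x < ε / 3 := hz
  have := dist_triangle4 (L i x) (L i z) z x
  rw [dist_comm] at h1
  rw [dist_comm] at h2
  linarith [dist_comm x z, dist_comm (L i x) (L i z)]

lemma cauchySeq_apply_of_dense_of_norm_le_one {L : ℕ → E →L[ℂ] E} (hL : ∀ n, ‖L n‖ ≤ 1)
    {D : Set E} (hD : Dense D) (h : ∀ x ∈ D, CauchySeq fun n => L n x) (x : E) :
    CauchySeq fun n => L n x := by
  rw [Metric.cauchySeq_iff]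
  intro ε hε
  obtain ⟨z, hz, hxz⟩ := Metric.dense_iff.1 hD x (ε / 3) (by positivity)
  obtain ⟨N, hN⟩ := Metric.cauchySeq_iff.1 (h z hxz) (ε / 3) (by positivity)
  refine ⟨N, fun m hm n hn => ?_⟩
  have h1 : ∀ k, dist (L k x) (L k z) ≤ dist z x := fun k => by
    rw [dist_comm z, dist_eq_norm, dist_eq_norm, ← map_sub]
    exact ((L k).le_of_opNorm_le_of_le (hL k) le_rfl).trans_eq (one_mul _)
  have h2 : dist z x < ε / 3 := hz
  have := dist_triangle4 (L m x) (L m z) (L n z) (L n x)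
  linarith [h1 m, h1 n, hN m hm n hn, dist_comm (L n x) (L n z)]

end DenseConvergence

/-! ### The limit semigroup of commuting contractive exponentials. -/

section Generation

variable {E : Type*} [NormedAddCommGroup E] [NormedSpace ℂ E] [CompleteSpace E]

-- Only the values of `F` on `D` matter, and the generator of `T` is only shown to extend `F`
-- restricted to `D`.
open NormedSpace in
lemma exists_contractionC0Semigroup_of_tendsto {B : ℕ → E →L[ℂ] E}
    (hB : ∀ n, HasContractiveExp (B n)) (hcomm : ∀ m n, Commute (B m) (B n))
    {D : Set E} (hD : Dense D) {F : E → E}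
    (hF : ∀ x ∈ D, Tendsto (fun n => B n x) atTop (𝓝 (F x))) :
    ∃ T : ℝ → E →L[ℂ] E, IsContractionC0Semigroup T ∧
      ∀ x ∈ D, Tendsto (fun t : ℝ => t⁻¹ • (T t x - x)) (𝓝[>] 0) (𝓝 (F x)) := by
  have hcauchy : ∀ t : ℝ, 0 ≤ t → ∀ x, CauchySeq fun n => exp (t • B n) x := by
    intro t ht
    refine cauchySeq_apply_of_dense_of_norm_le_one (fun n => hB n t ht) hD fun x hx => ?_
    have h := (hF x hx).cauchySeq
    rw [Metric.cauchySeq_iff] at h ⊢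
    intro ε hε
    obtain ⟨N, hN⟩ := h (ε / (t + 1)) (by positivity)
    refine ⟨N, fun m hm n hn => ?_⟩
    have h1 := (hB m).norm_apply_sub_apply_le (hB n) (hcomm m n) ht x
    have h2 := hN m hm n hn
    rw [lt_div_iff₀ (by positivity), dist_eq_norm] at h2
    rw [dist_eq_norm]
    nlinarith [norm_nonneg (B m x - B n x)]
  have hex : ∀ t : ℝ, ∃ L : E →L[ℂ] E, 0 ≤ t →
      ∀ x, Tendsto (fun n => exp (t • B n) x) atTop (𝓝 (L x)) := by
    intro t
    by_cases ht : 0 ≤ t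
    · choose g hg using fun x => cauchySeq_tendsto_of_complete (hcauchy t ht x)
      refine ⟨continuousLinearMapOfTendsto (𝕜₁ := ℂ) (𝕜₂ := ℂ) (fun n => exp (t • B n))
        (f := g) (tendsto_pi_nhds.2 hg), fun _ x => hg x⟩
    · exact ⟨0, fun h => absurd h ht⟩
  choose T hT using hex
  have hnorm : ∀ t : ℝ, 0 ≤ t → ‖T t‖ ≤ 1 := fun t ht =>
    ContinuousLinearMap.opNorm_le_bound _ zero_le_one fun x => by
      rw [one_mul]
      exact le_of_tendsto (hT t ht x).norm
        (Eventually.of_forall fun n => (hB n).norm_apply_le ht x)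
  have hest : ∀ x ∈ D, ∀ z ∈ D, ∀ t : ℝ, 0 ≤ t →
      ‖T t x - x - t • F x‖ ≤ t * (2 * ‖F x - z‖ + t * ‖F z‖) := by
    intro x hx z hz t ht
    refine le_of_tendsto_of_tendsto
      (((hT t ht x).sub_const x).sub ((hF x hx).const_smul t)).norm
      (((((hF x hx).sub_const z).norm.const_mul 2).add ((hF z hz).norm.const_mul t)).const_mul t)
      (Eventually.of_forall fun n => (hB n).norm_apply_sub_sub_le ht x z)
  have hgen : ∀ x ∈ D, Tendsto (fun t : ℝ => t⁻¹ • (T t x - x)) (𝓝[>] 0) (𝓝 (F x)) := by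
    intro x hx
    rw [Metric.tendsto_nhds]
    intro ε hε
    obtain ⟨z, hz, hzD⟩ := Metric.dense_iff.1 hD (F x) (ε / 4) (by positivity)
    rw [Metric.mem_ball, dist_comm, dist_eq_norm] at hz
    have hsmall : ∀ᶠ t : ℝ in 𝓝[>] 0, t * ‖F z‖ < ε / 2 := by
      have : Tendsto (fun t : ℝ => t * ‖F z‖) (𝓝[>] 0) (𝓝 0) := by
        have h : Continuous fun t : ℝ => t * ‖F z‖ := by fun_prop
        simpa using (h.tendsto 0).mono_left nhdsWithin_le_nhds
      exact this.eventually (gt_mem_nhds (by positivity))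
    filter_upwards [hsmall, self_mem_nhdsWithin] with t hts ht
    have ht : (0 : ℝ) < t := ht
    have h1 : t⁻¹ • (T t x - x) - F x = t⁻¹ • (T t x - x - t • F x) := by
      rw [smul_sub _ (T t x - x), inv_smul_smul₀ ht.ne']
    rw [dist_eq_norm, h1, norm_smul, Real.norm_of_nonneg (inv_nonneg.2 ht.le)]
    refine ((inv_mul_le_iff₀ ht).2 (hest x hx z hzD t ht.le)).trans_lt ?_
    linarith
  refine ⟨T, ⟨⟨?_, ?_, ?_⟩, by simpa using hnorm⟩, hgen⟩
  · ext x
    refine tendsto_nhds_unique (hT 0 le_rfl x) ?_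
    simp
  · intro t s ht hs
    ext x
    refine tendsto_nhds_unique (hT (t + s) (add_nonneg ht hs) x) ?_
    -- The inner limit is moved out of `e^{tBₙ}` at no cost, these being contractions.
    have h1 : Tendsto (fun n => exp (t • B n) (exp (s • B n) x - T s x)) atTop (𝓝 0) :=
      squeeze_zero_norm (fun n => (hB n).norm_apply_le ht _)
        (tendsto_iff_norm_sub_tendsto_zero.1 (hT s hs x))
    have h2 := h1.add (hT t ht (T s x))
    rw [zero_add] at h2
    refine h2.congr fun n => ?_
    rw [exp_add_smul_real t s (B n), map_sub, sub_add_cancel, mul_apply_eq_comp]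
  · refine tendsto_apply_of_dense_of_norm_le_one ?_ hD fun x hx => ?_
    · filter_upwards [self_mem_nhdsWithin] with t ht using hnorm t (le_of_lt ht)
    -- On `D`, differentiability at `0` implies continuity there.
    · have h1 : Tendsto (fun t : ℝ => t) (𝓝[>] 0) (𝓝 0) := nhdsWithin_le_nhds
      have h2 := (h1.smul (hgen x hx)).add_const x
      rw [zero_smul, zero_add] at h2
      refine h2.congr' ?_
      filter_upwards [self_mem_nhdsWithin] with t ht
      rw [smul_inv_smul₀ (ne_of_gt ht), sub_add_cancel]

end Generation

/-! ### Sufficiency: resolvents, Yosida approximations and maximality. -/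

section Resolvent

variable {E : Type*} [NormedAddCommGroup E] [NormedSpace ℂ E] {A : E →ₗ.[ℂ] E}

/-- Pair `lx - Ax` with the functional `f ∈ J(x)` from dissipativity: the real part is at least
`l‖x‖²` and at most `‖x‖‖lx - Ax‖`. -/
lemma IsDissipative.mul_norm_le (hA : IsDissipative A) (l : ℝ) (x : A.domain) :
    l * ‖(x : E)‖ ≤ ‖l • (x : E) - A x‖ := by
  obtain ⟨f, hf, hfA⟩ := hA x
  have h1 := re_apply_le_of_mem_dualityMap hf (l • (x : E) - A x)
  have h2 : (f (l • (x : E) - A x)).re = l * ‖(x : E)‖ ^ 2 - (f (A x)).re := by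
    rw [← Complex.coe_smul, map_sub, map_smul, hf.1, smul_eq_mul, Complex.sub_re,
      Complex.re_ofReal_mul, Complex.ofReal_re]
  rcases (norm_nonneg (x : E)).eq_or_lt with h0 | h0
  · rw [← h0, mul_zero]
    exact norm_nonneg _
  · refine le_of_mul_le_mul_left ?_ h0
    rw [h2] at h1
    nlinarith

/-- `R` is the resolvent of `A` at the real number `l`, with the norm bound that holds for
dissipative operators. -/
structure IsContractiveResolvent (A : E →ₗ.[ℂ] E) (l : ℝ) (R : E →L[ℂ] E) : Prop where
  pos : 0 < l
  mem : ∀ y, R y ∈ A.domain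
  right_inv : ∀ y, l • R y - A ⟨R y, mem y⟩ = y
  left_inv : ∀ x : A.domain, R (l • (x : E) - A x) = x
  norm_le : ‖R‖ ≤ l⁻¹

lemma IsDissipative.exists_isContractiveResolvent (hA : IsDissipative A) {l : ℝ} (hl : 0 < l)
    (hsurj : ∀ y, ∃ x : A.domain, l • (x : E) - A x = y) :
    ∃ R, IsContractiveResolvent A l R := by
  choose g hg using hsurj
  have hbound : ∀ x : A.domain, ‖(x : E)‖ ≤ l⁻¹ * ‖l • (x : E) - A x‖ := fun x =>
    (le_inv_mul_iff₀ hl).2 (hA.mul_norm_le l x)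
  have hinj : ∀ x x' : A.domain, l • (x : E) - A x = l • (x' : E) - A x' → x = x' := by
    intro x x' h
    have h1 := hbound (x - x')
    have h2 : l • ((x - x' : A.domain) : E) - A (x - x') = 0 := by
      rw [A.map_sub, Submodule.coe_sub, smul_sub, sub_sub_sub_comm, h, sub_self]
    rw [h2, norm_zero, mul_zero, norm_le_zero_iff] at h1
    exact sub_eq_zero.1 (Subtype.ext h1)
  let L : E →ₗ[ℂ] E :=
    { toFun := fun y => g y
      map_add' := fun y z => by
        rw [← Submodule.coe_add]
        refine congrArg _ (hinj _ _ ?_)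
        rw [hg, A.map_add, Submodule.coe_add, smul_add, add_sub_add_comm, hg, hg]
      map_smul' := fun c y => by
        rw [RingHom.id_apply, ← Submodule.coe_smul]
        refine congrArg _ (hinj _ _ ?_)
        rw [hg, A.map_smul, Submodule.coe_smul, smul_comm l c, ← smul_sub, hg] }
  refine ⟨L.mkContinuous l⁻¹ fun y => ?_, hl, fun y => (g y).2, fun y => hg y, fun x => ?_, ?_⟩
  · have := hbound (g y)
    rwa [hg] at this
  · exact congrArg Subtype.val (hinj _ _ (hg _))
  · exact L.mkContinuous_norm_le (inv_nonneg.2 hl.le) _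

namespace IsContractiveResolvent

variable {l m : ℝ} {R S : E →L[ℂ] E}

lemma apply_eq (hR : IsContractiveResolvent A l R) (y : E) :
    A ⟨R y, hR.mem y⟩ = l • R y - y :=
  eq_sub_of_add_eq' (sub_eq_iff_eq_add.1 (hR.right_inv y)).symm

lemma norm_smul_le_one (hR : IsContractiveResolvent A l R) : ‖l • R‖ ≤ 1 := by
  rw [norm_smul, Real.norm_of_nonneg hR.pos.le]
  exact (mul_le_mul_of_nonneg_left hR.norm_le hR.pos.le).trans_eq (mul_inv_cancel₀ hR.pos.ne')

/-- The resolvent identity; exchanging the two resolvents in it yields their commutation. -/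
lemma comp_sub_comp (hR : IsContractiveResolvent A l R) (hS : IsContractiveResolvent A m S)
    (x : E) : R x - S x = (m - l) • R (S x) := by
  have h1 := hR.left_inv ⟨S x, hS.mem x⟩
  have h2 : l • S x - A ⟨S x, hS.mem x⟩ = x - (m - l) • S x := by
    rw [hS.apply_eq]
    module
  simp only [h2] at h1
  rw [map_sub, ← Complex.coe_smul, map_smul, Complex.coe_smul] at h1
  exact sub_eq_iff_eq_add.2 ((sub_eq_iff_eq_add.1 h1).trans (add_comm _ _))

lemma commute (hR : IsContractiveResolvent A l R) (hS : IsContractiveResolvent A m S) :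
    Commute R S := by
  rcases eq_or_ne l m with rfl | h
  · have : R = S := by
      ext x
      simpa [sub_eq_zero] using hR.comp_sub_comp hS x
    rw [this]
  · ext x
    have h1 := hR.comp_sub_comp hS x
    have h2 := hS.comp_sub_comp hR x
    have h3 : (m - l) • R (S x) = (m - l) • S (R x) := by
      rw [← h1, ← neg_sub l m, neg_smul, ← h2, neg_sub]
    exact smul_right_injective E (sub_ne_zero.2 h.symm) h3

/-- Factor `m - A = (1 - (l - m)R)(l - A)`; the first factor is invertible by the Neumann series, as
`|l - m|/l < 1` exactly when `0 < m < 2l`. -/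
lemma surjective_of_lt_two_mul [CompleteSpace E] (hR : IsContractiveResolvent A l R)
    (hm : 0 < m) (hml : m < 2 * l) (y : E) : ∃ x : A.domain, m • (x : E) - A x = y := by
  have hlt : ‖(l - m) • R‖ < 1 := by
    rw [norm_smul, Real.norm_eq_abs]
    refine (mul_le_mul_of_nonneg_left hR.norm_le (abs_nonneg _)).trans_lt ?_
    rw [← div_eq_mul_inv, div_lt_one hR.pos, abs_lt]
    constructor <;> linarith
  let u := Units.oneSub ((l - m) • R) hlt
  set z : E := (↑u⁻¹ : E →L[ℂ] E) y with hz
  have h1 : z - (l - m) • R z = y := by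
    have h : ((u : E →L[ℂ] E) * (↑u⁻¹ : E →L[ℂ] E)) y = y := by rw [u.mul_inv]; rfl
    exact h
  refine ⟨⟨R z, hR.mem z⟩, ?_⟩
  rw [← h1, hR.apply_eq]
  module

/-- The Yosida approximations of `A` generate semigroups of contractions. -/
lemma hasContractiveExp [CompleteSpace E] (hR : IsContractiveResolvent A l R) :
    HasContractiveExp (l • (l • R - 1)) := fun t ht => by
  rw [smul_smul]
  exact norm_exp_smul_sub_one_le ContinuousLinearMap.norm_id_le hR.norm_smul_le_one
    (mul_nonneg ht hR.pos.le)

lemma smul_apply_sub (hR : IsContractiveResolvent A l R) (x : A.domain) :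
    l • R x - x = R (A x) := by
  have h := hR.left_inv x
  rw [map_sub, ← Complex.coe_smul, map_smul, Complex.coe_smul] at h
  exact sub_eq_iff_eq_add.2 ((sub_eq_iff_eq_add.1 h).trans (add_comm _ _))

end IsContractiveResolvent

/-- On `D(A)`, `lRx - x = R(Ax)` has norm at most `‖Ax‖/l`; density and `‖lR‖ ≤ 1` do the rest. -/
lemma tendsto_smul_resolvent (hA : Dense (A.domain : Set E)) {l : ℕ → ℝ} {R : ℕ → E →L[ℂ] E}
    (hR : ∀ n, IsContractiveResolvent A (l n) (R n)) (hl : Tendsto l atTop atTop) (x : E) :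
    Tendsto (fun n => (l n • R n) x) atTop (𝓝 x) := by
  refine tendsto_apply_of_dense_of_norm_le_one
    (Eventually.of_forall fun n => (hR n).norm_smul_le_one) hA (fun x hx => ?_) x
  rw [tendsto_iff_norm_sub_tendsto_zero]
  have h0 := hl.inv_tendsto_atTop.mul_const ‖A ⟨x, hx⟩‖
  rw [zero_mul] at h0
  refine squeeze_zero (fun _ => norm_nonneg _) (fun n => ?_) h0
  rw [smul_apply, (hR n).smul_apply_sub ⟨x, hx⟩]
  exact (R n).le_of_opNorm_le (hR n).norm_le _

lemma IsMDissipative.exists_resolvents [CompleteSpace E] (hA : IsMDissipative A) :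
    ∃ (l : ℕ → ℝ) (R : ℕ → E →L[ℂ] E), Tendsto l atTop atTop ∧
      ∀ n, IsContractiveResolvent A (l n) (R n) := by
  obtain ⟨a, ha, hsurj⟩ := hA.exists_range_eq_univ
  -- Any ratio strictly between 1 and 2 would do: each step stays within reach of the Neumann series
  -- and the sequence diverges.
  have h : ∀ n : ℕ, ∃ R, IsContractiveResolvent A (a * (3 / 2) ^ n) R := by
    intro n
    induction n with
    | zero =>
      refine hA.isDissipative.exists_isContractiveResolvent (by positivity) fun y => ?_
      obtain ⟨x, hx⟩ := hsurj.symm ▸ Set.mem_univ y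
      exact ⟨x, by simpa using hx⟩
    | succ n ih =>
      obtain ⟨R, hR⟩ := ih
      refine hA.isDissipative.exists_isContractiveResolvent (by positivity)
        (hR.surjective_of_lt_two_mul (by positivity) ?_)
      rw [pow_succ]
      nlinarith [hR.pos]
  choose R hR using h
  exact ⟨_, R, (tendsto_pow_atTop_atTop_of_one_lt (by norm_num)).const_mul_atTop ha, hR⟩

lemma IsMDissipative.exists_isInfinitesimalGenerator [CompleteSpace E] (hA : IsMDissipative A)
    (hdense : Dense (A.domain : Set E)) :
    ∃ T : ℝ → E →L[ℂ] E, IsContractionC0Semigroup T ∧ IsInfinitesimalGenerator A T := by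
  classical
  obtain ⟨l, R, hl, hR⟩ := hA.exists_resolvents
  let F : E → E := fun x => if hx : x ∈ A.domain then A ⟨x, hx⟩ else 0
  have hF : ∀ x ∈ (A.domain : Set E),
      Tendsto (fun n => (l n • (l n • R n - 1)) x) atTop (𝓝 (F x)) := by
    intro x hx
    have hFx : F x = A ⟨x, hx⟩ := dif_pos hx
    rw [hFx]
    -- On `D(A)` the Yosida approximation equals `lₙRₙA`.
    refine (tendsto_smul_resolvent hdense hR hl (A ⟨x, hx⟩)).congr fun n => ?_
    simp only [smul_apply, sub_apply,
      one_apply_eq_self]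
    rw [(hR n).smul_apply_sub ⟨x, hx⟩]
  have hcomm : ∀ m n, Commute (l m • (l m • R m - 1)) (l n • (l n • R n - 1)) := by
    intro m n
    have h := (((hR m).commute (hR n)).smul_left (l m)).smul_right (l n)
    exact ((((h.sub_left (Commute.one_left _)).sub_right
      (Commute.one_right _))).smul_left (l m)).smul_right (l n)
  obtain ⟨T, hT, hgen⟩ := exists_contractionC0Semigroup_of_tendsto
    (fun n => (hR n).hasContractiveExp) hcomm hdense hF
  have hgen' : ∀ x : A.domain,
      Tendsto (fun t : ℝ => t⁻¹ • (T t (x : E) - x)) (𝓝[>] 0) (𝓝 (A x)) := fun x => by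
    have hFx : F x = A x := dif_pos x.2
    exact hFx ▸ hgen x x.2
  refine ⟨T, hT, fun x => ⟨fun hx => ⟨_, hgen' ⟨x, hx⟩⟩, ?_⟩, hgen'⟩
  rintro ⟨y, hy⟩
  -- `x'` solves `l₀x' - Ax' = l₀x - y`, so `x - x'` is sent to `l₀(x - x')` by the generator of
  -- `T`; dissipativity with `l₀ > 0` forces `x = x'`.
  set x' : A.domain := ⟨R 0 (l 0 • x - y), (hR 0).mem _⟩ with hx'
  have hA' : A x' = l 0 • (x' : E) - (l 0 • x - y) :=
    (hR 0).apply_eq _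
  have hw : Tendsto (fun t : ℝ => t⁻¹ • (T t (x - x') - (x - x'))) (𝓝[>] 0)
      (𝓝 (l 0 • (x - (x' : E)))) := by
    have h := hy.sub (hgen' x')
    have e : y - A x' = l 0 • (x - (x' : E)) := by rw [hA']; module
    rw [e] at h
    refine h.congr fun t => ?_
    rw [map_sub]
    module
  obtain ⟨f, hf⟩ := dualityMap_nonempty (x - (x' : E))
  have h := hT.re_apply_nonpos hw hf
  rw [← Complex.coe_smul, map_smul, hf.1, smul_eq_mul, Complex.re_ofReal_mul,
    Complex.ofReal_re] at h
  have h0 : ‖x - (x' : E)‖ ^ 2 = 0 :=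
    le_antisymm (nonpos_of_mul_nonpos_right h (hR 0).pos) (sq_nonneg _)
  rw [sub_eq_zero.1 (norm_eq_zero.1 (pow_eq_zero_iff two_ne_zero |>.1 h0))]
  exact x'.2

end Resolvent

theorem mainTheorem7 {E : Type*} [NormedAddCommGroup E] [NormedSpace ℂ E] [CompleteSpace E]
    (A : E →ₗ.[ℂ] E) (hA : Dense (A.domain : Set E)) :
    (∃ T : ℝ → E →L[ℂ] E, IsContractionC0Semigroup T ∧ IsInfinitesimalGenerator A T) ↔
      IsMDissipative A :=
  ⟨fun ⟨_, hT, hgen⟩ => hgen.isMDissipative hT, fun h => h.exists_isInfinitesimalGenerator hA⟩
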